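/- **Compactifications.** Let $\mathsf{C}omp$ be the category whose objects are compactifications $e : X \to Y$, that is, topological embeddings with dense image of a completely regular (Hausdorff) space $X$ into a compact Hausdorff space $Y$. A morphism from $e : X \to Y$ to $e' : X' \to Y'$ is a pair $(f,g)$ of continuous maps $f : X \to X'$, $g : Y \to Y'$ with $g \circ e = e' \circ f$, and composition is componentwise. **De Vries algebras.** A de Vries algebra $\mathfrak A = (A,\prec)$ is a complete Boolean algebra $A$ with a binary relation $\prec$ such that: $1 \prec 1$; $a \prec b$ implies $a \le b$; $a \le b \prec c \le d$ implies $a \prec d$; $a \prec b$ and $a \prec c$ imply $a \prec b \wedge c$; $a \prec b$ implies $\neg b \prec \neg a$; $a \prec b$ implies that $a \prec c \prec b$ for some $c$; and $b \neq 0$ implies that $a \prec b$ for some $a \neq 0$. A de Vries morphism $\rho : \mathfrak A \to \mathfrak A'$ is a map such that $\rho(0) = 0$; $\rho(a \wedge b) = \rho(a) \wedge \rho(b)$; $a \prec b$ implies $\neg\rho(\neg a) \prec \rho(b)$; and $\rho(b) = \bigvee\{\rho(a) \mid a \prec b\}$. De Vries morphisms are composed by $(\rho_2 \star \rho_1)(b)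 = \bigvee \{\rho_2\rho_1(a) \mid a \prec b\}$. **De Vries extensions.** A de Vries extension is an injective de Vries morphism $\alpha : \mathfrak A \to \mathfrak B$, where $\mathfrak B = (B, \le)$ for a complete and atomic Boolean algebra $B$, such that each element of $B$ is a join of meets of elements of $\alpha[\mathfrak A]$. Let $\mathsf{DeVe}$ be the category of de Vries extensions. A morphism from $\alpha : \mathfrak A \to \mathfrak B$ to $\alpha' : \mathfrak A' \to \mathfrak B'$ is a pair $(\rho,\sigma)$ of a de Vries morphism $\rho : \mathfrak A \to \mathfrak A'$ and a complete Boolean homomorphism $\sigma : B \to B'$ with $\sigma \circ \alpha = \alpha' \star \rho$. Composition is $(\rho_2,\sigma_2)\circ(\rho_1,\sigma_1) = (\rho_2 \star \rho_1, \sigma_2 \circ \sigma_1)$. **The functor $\mathsf E$.** For a compact Hausdorff space $Y$, let $\mathcal{RO}(Y)$ be the de Vries algebra of regular open subsets of $Y$, with $U \prec V$ iff $\mathrm{cl}(U) \subseteq V$, and let $\wp(X)$ be the powerset of $X$ with proximity $\subseteq$. The contravariant functor $\mathsf E : \mathsf{C}omp \to \mathsf{DeVe}$ sends $e : X \to Y$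 to $e^{-1} : \mathcal{RO}(Y) \to \wp(X)$ and $(f,g)$ to $(g^*, f^{-1})$, where $g^*(U) = \mathrm{int}(\mathrm{cl}(g^{-1}(U)))$. **The functor $\mathsf C$.** For $S \subseteq \mathfrak A$ put $\Uparrow S = \{a \in \mathfrak A \mid b \prec a \text{ for some } b \in S\}$. An end of $\mathfrak A$ is a maximal element of the set of proper filters $F$ with $\Uparrow F = F$. Let $Y_{\mathfrak A}$ be the set of ends, with the topology that has the sets $\{y \mid a \in y\}$, $a \in \mathfrak A$, as a basis. For a de Vries morphism $\rho : \mathfrak A \to \mathfrak A'$ let $\rho_* : Y_{\mathfrak A'} \to Y_{\mathfrak A}$, $\rho_*(y) = \Uparrow \rho^{-1}(y)$. For a de Vries extension $\alpha : \mathfrak A \to \mathfrak B$ let $X_{\mathfrak B}$ be the set of atoms of $B$; identifying an atom $b$ with the end $\uparrow b$ of $\mathfrak B$, give $X_{\mathfrak B}$ the least topology making the restriction $\alpha_* : X_{\mathfrak B} \to Y_{\mathfrak A}$ continuous. For a complete Boolean homomorphism $\sigma : B \to B'$ let $\sigma_+ : X_{\mathfrak B'} \to X_{\mathfrak B}$,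 $\sigma_+(x) = \bigwedge\{b \in B \mid x \le \sigma(b)\}$. The contravariant functor $\mathsf C : \mathsf{DeVe} \to \mathsf{C}omp$ sends $\alpha : \mathfrak A \to \mathfrak B$ to $\alpha_* : X_{\mathfrak B} \to Y_{\mathfrak A}$ and $(\rho,\sigma)$ to $(\sigma_+, \rho_*)$. **Theorem.** The contravariant functors $\mathsf E$ and $\mathsf C$ form a dual equivalence between the category $\mathsf{C}omp$ of compactifications and the category $\mathsf{DeVe}$ of de Vries extensions. -/

import Mathlib

open CategoryTheory Set Topology

universe u

namespace DeVries

/-! ### De Vries algebras and de Vries morphisms -/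

/-- The axioms of a de Vries proximity on a Boolean algebra. -/
structure IsDeVriesProximity {A : Type u} [BooleanAlgebra A] (r : A → A → Prop) : Prop where
  top_top : r ⊤ ⊤
  le_of_prox : ∀ {a b : A}, r a b → a ≤ b
  mono : ∀ {a b c d : A}, a ≤ b → r b c → c ≤ d → r a d
  inf_right : ∀ {a b c : A}, r a b → r a c → r a (b ⊓ c)
  compl : ∀ {a b : A}, r a b → r bᶜ aᶜ
  interpolate : ∀ {a b : A}, r a b → ∃ c, r a c ∧ r c b
  exists_prox : ∀ {b : A}, b ≠ ⊥ → ∃ a, a ≠ ⊥ ∧ r a b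

/-- A de Vries algebra: a complete Boolean algebra with a de Vries proximity. -/
structure DeVriesAlgebra : Type (u + 1) where
  carrier : Type u
  [completeBooleanAlgebra : CompleteBooleanAlgebra carrier]
  prox : carrier → carrier → Prop
  isProx : IsDeVriesProximity prox

instance : CoeSort DeVriesAlgebra.{u} (Type u) := ⟨DeVriesAlgebra.carrier⟩

instance (A : DeVriesAlgebra.{u}) : CompleteBooleanAlgebra A := A.completeBooleanAlgebra

/-- The extremally disconnected de Vries algebra `(B, ≤)` of a complete Boolean algebra `B`. -/
abbrev extremallyDisconnected (B : Type u) [CompleteBooleanAlgebra B] : DeVriesAlgebra.{u} where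
  carrier := B
  prox := fun a b => a ≤ b
  isProx :=
    { top_top := le_rfl
      le_of_prox := fun h => h
      mono := fun h₁ h₂ h₃ => h₁.trans (h₂.trans h₃)
      inf_right := fun h₁ h₂ => le_inf h₁ h₂
      compl := fun h => compl_le_compl h
      interpolate := fun {a _} h => ⟨a, le_rfl, h⟩
      exists_prox := fun {b} h => ⟨b, h, le_rfl⟩ }

/-- De Vries morphisms. -/
@[ext]
structure DeVriesHom (A B : DeVriesAlgebra.{u}) : Type u where
  toFun : A → B
  map_bot : toFun ⊥ = ⊥
  map_inf : ∀ a b : A, toFun (a ⊓ b) = toFun a ⊓ toFun b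
  map_prox : ∀ a b : A, A.prox a b → B.prox (toFun aᶜ)ᶜ (toFun b)
  map_sSup : ∀ b : A, toFun b = sSup {x : B | ∃ a : A, A.prox a b ∧ toFun a = x}

instance (A B : DeVriesAlgebra.{u}) : CoeFun (DeVriesHom A B) (fun _ => A → B) :=
  ⟨DeVriesHom.toFun⟩

section

variable {A B C D : DeVriesAlgebra.{u}}

theorem prox_bot {a : A} (h : A.prox a ⊥) : a = ⊥ := le_bot_iff.1 (A.isProx.le_of_prox h)

theorem bot_prox (a : A) : A.prox ⊥ a := by
  have h := A.isProx.compl A.isProx.top_top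
  rw [compl_top] at h
  exact A.isProx.mono le_rfl h bot_le

theorem prox_top (a : A) : A.prox a ⊤ := A.isProx.mono le_top A.isProx.top_top le_rfl

theorem prox_inf_inf {a b c d : A} (h₁ : A.prox a b) (h₂ : A.prox c d) :
    A.prox (a ⊓ c) (b ⊓ d) :=
  A.isProx.inf_right (A.isProx.mono inf_le_left h₁ le_rfl)
    (A.isProx.mono inf_le_right h₂ le_rfl)

theorem prox_trans {a b c : A} (h₁ : A.prox a b) (h₂ : A.prox b c) : A.prox a c :=
  A.isProx.mono (A.isProx.le_of_prox h₁) h₂ le_rfl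

theorem eq_sSup_prox (b : A) : b = sSup {x : A | A.prox x b} := by
  apply le_antisymm
  · by_contra hlt
    have hne : b ⊓ (sSup {x : A | A.prox x b})ᶜ ≠ ⊥ := fun h =>
      hlt (by rwa [← disjoint_iff, disjoint_compl_right_iff] at h)
    obtain ⟨a, ha0, ha⟩ := A.isProx.exists_prox hne
    have h1 : A.prox a b := A.isProx.mono le_rfl ha inf_le_left
    have h2 : a ≤ sSup {x : A | A.prox x b} := le_sSup h1
    have h3 : a ≤ (sSup {x : A | A.prox x b})ᶜ := (A.isProx.le_of_prox ha).trans inf_le_right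
    exact ha0 (le_bot_iff.1 ((le_inf h2 h3).trans (inf_compl_eq_bot).le))
  · exact sSup_le fun x hx => A.isProx.le_of_prox hx

namespace DeVriesHom

theorem monotone (ρ : DeVriesHom A B) {a b : A} (h : a ≤ b) : ρ a ≤ ρ b := by
  have := ρ.map_inf a b
  rw [inf_eq_left.2 h] at this
  exact inf_eq_left.1 this.symm

theorem map_top (ρ : DeVriesHom A B) : ρ ⊤ = ⊤ := by
  have h := ρ.map_prox ⊤ ⊤ A.isProx.top_top
  rw [compl_top, ρ.map_bot, compl_bot] at h
  exact top_le_iff.1 (B.isProx.le_of_prox h)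

theorem map_le_compl (ρ : DeVriesHom A B) (a : A) : ρ a ≤ (ρ aᶜ)ᶜ := by
  rw [le_compl_iff_disjoint_right, disjoint_iff, ← ρ.map_inf, inf_compl_eq_bot, ρ.map_bot]

theorem prox_map (ρ : DeVriesHom A B) {a b : A} (h : A.prox a b) : B.prox (ρ a) (ρ b) :=
  B.isProx.mono (ρ.map_le_compl a) (ρ.map_prox a b h) le_rfl

end DeVriesHom

/-- The underlying function of the composition `ρ₂ ⋆ ρ₁` of de Vries morphisms. -/
def starFun (ρ₂ : DeVriesHom B C) (ρ₁ : DeVriesHom A B) (b : A) : C :=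
  sSup {x : C | ∃ a : A, A.prox a b ∧ ρ₂ (ρ₁ a) = x}

theorem le_starFun (ρ₂ : DeVriesHom B C) (ρ₁ : DeVriesHom A B) {a b : A} (h : A.prox a b) :
    ρ₂ (ρ₁ a) ≤ starFun ρ₂ ρ₁ b :=
  le_sSup ⟨a, h, rfl⟩

theorem starFun_le (ρ₂ : DeVriesHom B C) (ρ₁ : DeVriesHom A B) {b : A} {x : C}
    (h : ∀ a : A, A.prox a b → ρ₂ (ρ₁ a) ≤ x) : starFun ρ₂ ρ₁ b ≤ x :=
  sSup_le (by rintro _ ⟨a, ha, rfl⟩; exact h a ha)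

theorem starFun_le_comp (ρ₂ : DeVriesHom B C) (ρ₁ : DeVriesHom A B) (b : A) :
    starFun ρ₂ ρ₁ b ≤ ρ₂ (ρ₁ b) :=
  starFun_le _ _ fun _ ha => ρ₂.monotone (ρ₁.monotone (A.isProx.le_of_prox ha))

theorem starFun_mono (ρ₂ : DeVriesHom B C) (ρ₁ : DeVriesHom A B) {a b : A} (h : a ≤ b) :
    starFun ρ₂ ρ₁ a ≤ starFun ρ₂ ρ₁ b :=
  starFun_le _ _ fun _ hx => le_starFun _ _ (A.isProx.mono le_rfl hx h)

/-- The composition `ρ₂ ⋆ ρ₁` of de Vries morphisms. -/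
def star (ρ₂ : DeVriesHom B C) (ρ₁ : DeVriesHom A B) : DeVriesHom A C where
  toFun := starFun ρ₂ ρ₁
  map_bot := le_bot_iff.1 (starFun_le _ _ fun a ha => by
    rw [prox_bot ha, ρ₁.map_bot, ρ₂.map_bot])
  map_inf := fun a b => by
    apply le_antisymm
    · exact le_inf (starFun_mono _ _ inf_le_left) (starFun_mono _ _ inf_le_right)
    · rw [starFun, starFun, sSup_inf_sSup]
      refine iSup₂_le ?_
      rintro ⟨_, _⟩ ⟨⟨c, hc, rfl⟩, ⟨d, hd, rfl⟩⟩
      dsimp only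
      rw [← ρ₂.map_inf, ← ρ₁.map_inf]
      exact le_starFun _ _ (prox_inf_inf hc hd)
  map_prox := fun a b h => by
    obtain ⟨c, hac, hcb⟩ := A.isProx.interpolate h
    obtain ⟨d, hcd, hdb⟩ := A.isProx.interpolate hcb
    have h1 := ρ₂.map_prox _ _ (ρ₁.map_prox _ _ hcd)
    rw [compl_compl] at h1
    exact C.isProx.mono (compl_le_compl (le_starFun ρ₂ ρ₁ (A.isProx.compl hac))) h1
      (le_starFun ρ₂ ρ₁ hdb)
  map_sSup := fun b => by
    apply le_antisymm
    · refine starFun_le _ _ fun c hc => ?_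
      obtain ⟨d, hcd, hdb⟩ := A.isProx.interpolate hc
      exact (le_starFun ρ₂ ρ₁ hcd).trans (le_sSup ⟨d, hdb, rfl⟩)
    · refine sSup_le ?_
      rintro _ ⟨a, ha, rfl⟩
      exact starFun_mono _ _ (A.isProx.le_of_prox ha)

/-- The identity de Vries morphism. -/
def idHom (A : DeVriesAlgebra.{u}) : DeVriesHom A A where
  toFun := fun a => a
  map_bot := rfl
  map_inf := fun _ _ => rfl
  map_prox := fun a b h => by simpa using h
  map_sSup := fun b => by simpa using eq_sSup_prox b

theorem star_idHom (ρ : DeVriesHom A B) : star ρ (idHom A) = ρ :=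
  DeVriesHom.ext (funext fun b => (ρ.map_sSup b).symm)

theorem idHom_star (ρ : DeVriesHom A B) : star (idHom B) ρ = ρ :=
  DeVriesHom.ext (funext fun b => (ρ.map_sSup b).symm)

theorem star_assoc (ρ₃ : DeVriesHom C D) (ρ₂ : DeVriesHom B C) (ρ₁ : DeVriesHom A B) :
    star (star ρ₃ ρ₂) ρ₁ = star ρ₃ (star ρ₂ ρ₁) := by
  refine DeVriesHom.ext (funext fun b => le_antisymm ?_ ?_)
  · refine starFun_le _ _ fun a ha => ?_
    obtain ⟨c, hac, hcb⟩ := A.isProx.interpolate ha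
    refine le_trans (starFun_le_comp ρ₃ ρ₂ (ρ₁ a)) ?_
    exact (ρ₃.monotone (le_starFun ρ₂ ρ₁ hac)).trans (le_starFun ρ₃ (star ρ₂ ρ₁) hcb)
  · refine starFun_le _ _ fun a ha => ?_
    obtain ⟨c, hac, hcb⟩ := A.isProx.interpolate ha
    refine le_trans (ρ₃.monotone (starFun_le_comp ρ₂ ρ₁ a)) ?_
    exact (le_starFun ρ₃ ρ₂ (ρ₁.prox_map hac)).trans (le_starFun (star ρ₃ ρ₂) ρ₁ hcb)

end

/-! ### The category of de Vries extensions -/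

/-- A de Vries extension: an injective de Vries morphism `α : 𝔄 → (B, ≤)`, where `B` is a complete
and atomic Boolean algebra, such that every element of `B` is a join of meets of elements of the
image of `α`. -/
structure DeVriesExtension : Type (u + 1) where
  A : DeVriesAlgebra.{u}
  B : Type u
  [completeBooleanAlgebra : CompleteBooleanAlgebra B]
  [isAtomic : IsAtomic B]
  α : DeVriesHom A (extremallyDisconnected B)
  injective : Function.Injective α.toFun
  joinMeetDense : ∀ b : B, ∃ 𝒮 : Set (Set B),
    (∀ S ∈ 𝒮, S ⊆ Set.range α.toFun) ∧ b = sSup (sInf '' 𝒮)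

instance (a : DeVriesExtension.{u}) : CompleteBooleanAlgebra a.B := a.completeBooleanAlgebra

instance (a : DeVriesExtension.{u}) : IsAtomic a.B := a.isAtomic

namespace DeVriesExtension

/-- A morphism of de Vries extensions: a pair `(ρ, σ)` of a de Vries morphism and a complete Boolean
homomorphism with `σ ∘ α = α' ⋆ ρ`. (A map of complete Boolean algebras that preserves
arbitrary joins and meets also preserves complements.) -/
@[ext]
structure Hom (a a' : DeVriesExtension.{u}) : Type u where
  ρ : DeVriesHom a.A a'.A
  σ : CompleteLatticeHom a.B a'.B
  comm : ∀ x : a.A, σ (a.α x) = star a'.α ρ x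

/-- A complete homomorphism may be moved inside `⋆`. -/
theorem map_starFun {A A' : DeVriesAlgebra.{u}} {B B' : Type u} [CompleteBooleanAlgebra B]
    [CompleteBooleanAlgebra B'] (σ : CompleteLatticeHom B B')
    (α : DeVriesHom A' (extremallyDisconnected B)) (ρ : DeVriesHom A A') (x : A) :
    σ (starFun α ρ x) = sSup {y : B' | ∃ a : A, A.prox a x ∧ σ (α (ρ a)) = y} := by
  have h : σ (starFun α ρ x) = sSup (σ '' _) := sSupHomClass.map_sSup σ _
  rw [h]
  congr 1
  ext y
  constructor
  · rintro ⟨_, ⟨a, ha, rfl⟩, rfl⟩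
    exact ⟨a, ha, rfl⟩
  · rintro ⟨a, ha, rfl⟩
    exact ⟨_, ⟨a, ha, rfl⟩, rfl⟩

instance : Category DeVriesExtension.{u} where
  Hom := Hom
  id a :=
    { ρ := idHom a.A
      σ := CompleteLatticeHom.id a.B
      comm := fun x => by rw [star_idHom]; rfl }
  comp {a₁ a₂ a₃} φ ψ :=
    { ρ := star ψ.ρ φ.ρ
      σ := ψ.σ.comp φ.σ
      comm := fun x => by
        rw [← star_assoc]
        have h : ∀ y : a₂.A, ψ.σ (a₂.α y) = star a₃.α ψ.ρ y := ψ.comm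
        have h' : φ.σ (a₁.α x) = starFun a₂.α φ.ρ x := φ.comm x
        rw [CompleteLatticeHom.comp_apply, h', map_starFun]
        simp only [h]
        rfl }
  id_comp φ := Hom.ext (star_idHom _) rfl
  comp_id φ := Hom.ext (idHom_star _) rfl
  assoc φ ψ χ := Hom.ext (star_assoc _ _ _).symm rfl

end DeVriesExtension

/-! ### The category of compactifications -/

/-- A compactification `e : X → Y`: a dense embedding of a completely regular (Hausdorff) space `X`
into a compact Hausdorff space `Y`. -/
structure Compactification : Type (u + 1) where
  X : Type u
  Y : Type u
  [topX : TopologicalSpace X]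
  [topY : TopologicalSpace Y]
  [completelyRegular : T35Space X]
  [compact : CompactSpace Y]
  [hausdorff : T2Space Y]
  e : X → Y
  isEmbedding : IsEmbedding e
  denseRange : DenseRange e

namespace Compactification

instance (e : Compactification.{u}) : TopologicalSpace e.X := e.topX
instance (e : Compactification.{u}) : TopologicalSpace e.Y := e.topY
instance (e : Compactification.{u}) : T35Space e.X := e.completelyRegular
instance (e : Compactification.{u}) : CompactSpace e.Y := e.compact
instance (e : Compactification.{u}) : T2Space e.Y := e.hausdorff

/-- A morphism of compactifications: a pair `(f, g)` of continuous maps with `g ∘ e = e' ∘ f`. -/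
@[ext]
structure Hom (e e' : Compactification.{u}) : Type u where
  f : C(e.X, e'.X)
  g : C(e.Y, e'.Y)
  comm : ∀ x : e.X, g (e.e x) = e'.e (f x)

instance : Category Compactification.{u} where
  Hom := Hom
  id e :=
    { f := ContinuousMap.id e.X
      g := ContinuousMap.id e.Y
      comm := fun _ => rfl }
  comp φ ψ :=
    { f := ψ.f.comp φ.f
      g := ψ.g.comp φ.g
      comm := fun x => by
        change ψ.g (φ.g _) = _
        rw [φ.comm, ψ.comm]
        rfl }

end Compactification

/-! ### Regular open sets -/

/-- The regular open subsets of a space: those that are the interior of their closure. -/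
@[ext]
structure RO (Y : Type u) [TopologicalSpace Y] : Type u where
  carrier : Set Y
  regular : interior (closure carrier) = carrier

namespace RO

section

variable {Y : Type u} [TopologicalSpace Y]

theorem isOpen (U : RO Y) : IsOpen U.carrier := by
  rw [← U.regular]
  exact isOpen_interior

theorem interior_closure_idem (s : Set Y) :
    interior (closure (interior (closure s))) = interior (closure s) := by
  apply Subset.antisymm
  · exact interior_mono (closure_minimal interior_subset isClosed_closure)
  · exact interior_maximal subset_closure isOpen_interior

theorem subset_interior_closure {s : Set Y} (hs : IsOpen s) : s ⊆ interior (closure s) :=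
  interior_maximal subset_closure hs

/-- The regular open set `int (cl s)`. -/
def reg (s : Set Y) : RO Y := ⟨interior (closure s), interior_closure_idem s⟩

theorem reg_mono {s t : Set Y} (h : s ⊆ t) : (reg s).carrier ⊆ (reg t).carrier :=
  interior_mono (closure_mono h)

theorem reg_subset {s : Set Y} {U : RO Y} (h : s ⊆ U.carrier) : (reg s).carrier ⊆ U.carrier := by
  have := reg_mono h
  rwa [show (reg U.carrier).carrier = U.carrier from U.regular] at this

theorem interior_closure_inter {s t : Set Y} (hs : IsOpen s) (_ht : IsOpen t) :
    interior (closure (s ∩ t)) = interior (closure s) ∩ interior (closure t) := by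
  apply Subset.antisymm
  · exact subset_inter (interior_mono (closure_mono inter_subset_left))
      (interior_mono (closure_mono inter_subset_right))
  · refine interior_maximal ?_ (isOpen_interior.inter isOpen_interior)
    have h1 : interior (closure s) ∩ interior (closure t) ⊆
        closure (s ∩ interior (closure t)) := fun x hx =>
      (isOpen_interior.closure_inter) ⟨interior_subset hx.1, hx.2⟩
    have h2 : s ∩ interior (closure t) ⊆ closure (s ∩ t) := fun x hx =>
      hs.inter_closure ⟨hx.1, interior_subset hx.2⟩
    exact h1.trans (closure_minimal h2 isClosed_closure)

instance : PartialOrder (RO Y) := PartialOrder.lift RO.carrier (fun _ _ h => RO.ext h)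

theorem le_def {U V : RO Y} : U ≤ V ↔ U.carrier ⊆ V.carrier := Iff.rfl

instance : Max (RO Y) := ⟨fun U V => reg (U.carrier ∪ V.carrier)⟩

instance : Min (RO Y) := ⟨fun U V => ⟨U.carrier ∩ V.carrier, by
  rw [interior_closure_inter U.isOpen V.isOpen, U.regular, V.regular]⟩⟩

instance : SupSet (RO Y) := ⟨fun S => reg (⋃ U ∈ S, U.carrier)⟩

instance : InfSet (RO Y) := ⟨fun S => ⟨interior (⋂ U ∈ S, U.carrier), by
  apply Subset.antisymm
  · refine interior_maximal ?_ isOpen_interior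
    refine subset_iInter₂ fun U hU => ?_
    refine reg_subset (U := U) ?_
    exact interior_subset.trans (iInter₂_subset U hU)
  · exact subset_interior_closure isOpen_interior⟩⟩

instance : Compl (RO Y) := ⟨fun U => ⟨interior U.carrierᶜ, by
  have h : IsClosed U.carrierᶜ := U.isOpen.isClosed_compl
  have := interior_closure_idem U.carrierᶜ
  rwa [h.closure_eq] at this⟩⟩

instance : Top (RO Y) := ⟨⟨univ, by simp⟩⟩

instance : Bot (RO Y) := ⟨⟨∅, by simp⟩⟩

theorem carrier_sup (U V : RO Y) :
    (U ⊔ V).carrier = interior (closure (U.carrier ∪ V.carrier)) := rfl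

theorem carrier_inf (U V : RO Y) : (U ⊓ V).carrier = U.carrier ∩ V.carrier := rfl

theorem carrier_compl (U : RO Y) : Uᶜ.carrier = interior U.carrierᶜ := rfl

theorem carrier_sSup (S : Set (RO Y)) :
    (sSup S).carrier = interior (closure (⋃ U ∈ S, U.carrier)) := rfl

theorem carrier_sInf (S : Set (RO Y)) : (sInf S).carrier = interior (⋂ U ∈ S, U.carrier) := rfl

theorem carrier_top : (⊤ : RO Y).carrier = univ := rfl

theorem carrier_bot : (⊥ : RO Y).carrier = ∅ := rfl

instance : CompleteBooleanAlgebra (RO Y) where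
  sup := (· ⊔ ·)
  inf := (· ⊓ ·)
  le_sup_left U V := subset_union_left.trans
    (subset_interior_closure (U.isOpen.union V.isOpen))
  le_sup_right U V := subset_union_right.trans
    (subset_interior_closure (U.isOpen.union V.isOpen))
  sup_le U V W hU hV := reg_subset (union_subset hU hV)
  inf_le_left U V := inter_subset_left
  inf_le_right U V := inter_subset_right
  le_inf U V W hV hW := subset_inter hV hW
  isLUB_sSup S := by
    constructor
    · intro U hU
      refine (subset_biUnion_of_mem (u := RO.carrier) hU).trans ?_
      exact subset_interior_closure (isOpen_biUnion fun U _ => U.isOpen)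
    · intro V hV
      exact reg_subset (iUnion₂_subset fun U hU => hV hU)
  isGLB_sInf S := by
    constructor
    · intro U hU
      exact interior_subset.trans (iInter₂_subset U hU)
    · intro V hV
      exact interior_maximal (subset_iInter₂ fun U hU => hV hU) V.isOpen
  le_top U := subset_univ _
  bot_le U := empty_subset _
  le_sup_inf U V W := by
    change interior (closure (U.carrier ∪ V.carrier)) ∩ interior (closure (U.carrier ∪ W.carrier))
      ⊆ interior (closure (U.carrier ∪ (V.carrier ∩ W.carrier)))
    rw [← interior_closure_inter (U.isOpen.union V.isOpen) (U.isOpen.union W.isOpen),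
      ← union_inter_distrib_left]
  inf_compl_le_bot U := fun x hx => (interior_subset hx.2 : x ∈ U.carrierᶜ) hx.1
  top_le_sup_compl U := by
    change univ ⊆ interior (closure (U.carrier ∪ interior U.carrierᶜ))
    have : closure (U.carrier ∪ interior U.carrierᶜ) = univ := by
      rw [closure_union, interior_compl, eq_univ_iff_forall]
      intro x
      by_cases hx : x ∈ closure U.carrier
      · exact Or.inl hx
      · exact Or.inr (subset_closure hx)
    rw [this, interior_univ]

end

section

variable {Y : Type u} [TopologicalSpace Y] [CompactSpace Y] [T2Space Y]

theorem exists_mem_closure_subset {y : Y} {O : Set Y} (hO : IsOpen O) (hy : y ∈ O) :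
    ∃ V : RO Y, y ∈ V.carrier ∧ closure V.carrier ⊆ O := by
  obtain ⟨t, ht, htc, hts⟩ := exists_mem_nhds_isClosed_subset (hO.mem_nhds hy)
  refine ⟨reg (interior t), ?_, ?_⟩
  · exact subset_interior_closure isOpen_interior (mem_interior_iff_mem_nhds.2 ht)
  · refine (closure_minimal ?_ htc).trans hts
    exact interior_subset.trans (closure_minimal interior_subset htc)

theorem isDeVriesProximity :
    IsDeVriesProximity (fun U V : RO Y => closure U.carrier ⊆ V.carrier) where
  top_top := subset_univ _
  le_of_prox h := subset_closure.trans h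
  mono h₁ h₂ h₃ := (closure_mono h₁).trans (h₂.trans h₃)
  inf_right h₁ h₂ := subset_inter h₁ h₂
  compl {U V} h := by
    change closure (interior V.carrierᶜ) ⊆ interior U.carrierᶜ
    rw [interior_compl (s := U.carrier)]
    exact (closure_minimal interior_subset V.isOpen.isClosed_compl).trans
      (compl_subset_compl.2 h)
  interpolate {U V} h := by
    obtain ⟨O, hO, hUO, hOV⟩ := normal_exists_closure_subset isClosed_closure V.isOpen h
    refine ⟨reg O, hUO.trans (subset_interior_closure hO), ?_⟩
    exact (closure_minimal interior_subset isClosed_closure).trans hOV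
  exists_prox {V} h := by
    have hne : V.carrier.Nonempty := by
      rw [nonempty_iff_ne_empty]
      exact fun h' => h (RO.ext h')
    obtain ⟨y, hy⟩ := hne
    obtain ⟨U, hyU, hUV⟩ := exists_mem_closure_subset V.isOpen hy
    refine ⟨U, fun h' => ?_, hUV⟩
    rw [h'] at hyU
    exact hyU

end

end RO

/-- The de Vries algebra `Y^* = (RO(Y), ≺)` of regular open subsets of a compact Hausdorff space, with
the canonical proximity: `U ≺ V` iff the closure of `U` is contained in `V`. -/
abbrev upperStar (Y : Type u) [TopologicalSpace Y] [CompactSpace Y] [T2Space Y] :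
    DeVriesAlgebra.{u} where
  carrier := RO Y
  prox := fun U V => closure U.carrier ⊆ V.carrier
  isProx := RO.isDeVriesProximity

section

variable {Y Y' : Type u} [TopologicalSpace Y] [TopologicalSpace Y']

theorem preimage_subset_reg (g : C(Y, Y')) (U : RO Y') :
    g ⁻¹' U.carrier ⊆ (RO.reg (g ⁻¹' U.carrier)).carrier :=
  RO.subset_interior_closure (U.isOpen.preimage g.continuous)

theorem reg_preimage_subset (g : C(Y, Y')) {U : RO Y'} {s : Set Y'} (h : closure U.carrier ⊆ s) :
    (RO.reg (g ⁻¹' U.carrier)).carrier ⊆ g ⁻¹' s := by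
  refine interior_subset.trans ?_
  refine (closure_minimal ?_ (isClosed_closure.preimage g.continuous)).trans (preimage_mono h)
  exact preimage_mono subset_closure

end

section

variable {Y Y' Y'' : Type u} [TopologicalSpace Y] [CompactSpace Y] [T2Space Y]
  [TopologicalSpace Y'] [CompactSpace Y'] [T2Space Y']
  [TopologicalSpace Y''] [CompactSpace Y''] [T2Space Y'']

/-- The de Vries morphism `g^* : RO(Y') → RO(Y)`, `g^* U = int (cl (g⁻¹ U))`, dual to a continuous map
`g : Y → Y'`. -/
def upperStarMap (g : C(Y, Y')) : DeVriesHom (upperStar Y') (upperStar Y) where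
  toFun := fun U : RO Y' => RO.reg (g ⁻¹' U.carrier)
  map_bot := RO.ext (by
    change interior (closure (g ⁻¹' ∅)) = ∅
    simp)
  map_inf := fun U V : RO Y' => RO.ext
    (RO.interior_closure_inter (U.isOpen.preimage g.continuous) (V.isOpen.preimage g.continuous))
  map_prox := fun (U V : RO Y') (h : closure U.carrier ⊆ V.carrier) => by
    change closure (interior (RO.reg (g ⁻¹' (interior U.carrierᶜ))).carrierᶜ) ⊆
      (RO.reg (g ⁻¹' V.carrier)).carrier
    refine (closure_minimal interior_subset (RO.isOpen _).isClosed_compl).trans ?_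
    have h1 := preimage_subset_reg g Uᶜ
    refine (compl_subset_compl.2 h1).trans ?_
    rw [RO.carrier_compl, interior_compl, preimage_compl, compl_compl]
    exact (preimage_mono h).trans (preimage_subset_reg g V)
  map_sSup := fun V : RO Y' => by
    apply le_antisymm
    · refine RO.reg_subset ?_
      intro y hy
      obtain ⟨U, hU, hUV⟩ := RO.exists_mem_closure_subset V.isOpen hy
      have hle : (RO.reg (g ⁻¹' U.carrier)) ≤
          sSup {x : RO Y | ∃ a : RO Y', closure a.carrier ⊆ V.carrier ∧
            RO.reg (g ⁻¹' a.carrier) = x} := le_sSup ⟨U, hUV, rfl⟩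
      exact hle (preimage_subset_reg g U hU)
    · refine sSup_le ?_
      rintro _ ⟨U, hU, rfl⟩
      exact RO.reg_mono (preimage_mono (subset_closure.trans hU))

theorem upperStarMap_id : upperStarMap (ContinuousMap.id Y) = idHom (upperStar Y) :=
  DeVriesHom.ext (funext fun U : RO Y => RO.ext U.regular)

theorem upperStarMap_comp (g : C(Y, Y')) (h : C(Y', Y'')) :
    upperStarMap (h.comp g) = star (upperStarMap g) (upperStarMap h) := by
  refine DeVriesHom.ext (funext fun U : RO Y'' => le_antisymm ?_ ?_)
  · refine RO.reg_subset ?_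
    intro y hy
    obtain ⟨V, hV, hVU⟩ := RO.exists_mem_closure_subset U.isOpen hy
    have hle := le_starFun (upperStarMap g) (upperStarMap h) (a := V) (b := U) hVU
    refine (RO.le_def.1 hle) ?_
    refine preimage_subset_reg g (RO.reg (h ⁻¹' V.carrier)) ?_
    exact preimage_subset_reg h V hV
  · refine starFun_le _ _ fun (V : RO Y'') (hV : closure V.carrier ⊆ U.carrier) => ?_
    exact RO.reg_mono (preimage_mono (reg_preimage_subset h hV))

end

/-! ### The functor `E` -/

/-- The de Vries morphism `e⁻¹ : RO(Y) → ℘(X)` of a compactification `e : X → Y`. -/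
def preimageHom (e : Compactification.{u}) :
    DeVriesHom (upperStar e.Y) (extremallyDisconnected (Set e.X)) where
  toFun := fun U : RO e.Y => e.e ⁻¹' U.carrier
  map_bot := rfl
  map_inf := fun _ _ => rfl
  map_prox := fun (U V : RO e.Y) (h : closure U.carrier ⊆ V.carrier) => by
    change (e.e ⁻¹' (interior U.carrierᶜ))ᶜ ⊆ e.e ⁻¹' V.carrier
    rw [interior_compl, preimage_compl, compl_compl]
    exact preimage_mono h
  map_sSup := fun V : RO e.Y => by
    apply le_antisymm
    · intro x hx
      obtain ⟨U, hU, hUV⟩ := RO.exists_mem_closure_subset V.isOpen hx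
      exact ⟨e.e ⁻¹' U.carrier, ⟨U, hUV, rfl⟩, hU⟩
    · refine sSup_le ?_
      rintro _ ⟨U, hU, rfl⟩
      exact preimage_mono (subset_closure.trans hU)

/-- The de Vries extension `e⁻¹ : RO(Y) → ℘(X)` of a compactification `e : X → Y`. -/
def EObj (e : Compactification.{u}) : DeVriesExtension.{u} where
  A := upperStar e.Y
  B := Set e.X
  α := preimageHom e
  injective := by
    intro (U : RO e.Y) (V : RO e.Y) (h : e.e ⁻¹' U.carrier = e.e ⁻¹' V.carrier)
    have key : ∀ W : RO e.Y,
        W.carrier = interior (closure (e.e '' (e.e ⁻¹' W.carrier))) := fun W => by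
      have h1 : closure (e.e '' (e.e ⁻¹' W.carrier)) = closure W.carrier := by
        rw [image_preimage_eq_inter_range]
        apply Subset.antisymm (closure_mono inter_subset_left)
        refine closure_minimal ?_ isClosed_closure
        have hd : Dense (Set.range e.e) := e.denseRange
        exact hd.open_subset_closure_inter W.isOpen
      rw [h1, W.regular]
    exact RO.ext (by rw [key U, key V, h])
  joinMeetDense := fun s => by
    let S : e.X → Set (Set e.X) := fun x =>
      {t | x ∈ t ∧ ∃ U : RO e.Y, e.e ⁻¹' U.carrier = t}
    refine ⟨S '' s, ?_, ?_⟩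
    · rintro _ ⟨x, -, rfl⟩ t ⟨-, U, rfl⟩
      exact ⟨U, rfl⟩
    · have hS : ∀ x, sInf (S x) = {x} := fun x => by
        apply Subset.antisymm
        · intro x' hx'
          by_contra hne
          have hne' : e.e x ∈ ({e.e x'} : Set e.Y)ᶜ := fun h =>
            hne (e.isEmbedding.injective h).symm
          obtain ⟨U, hU, hU'⟩ :=
            RO.exists_mem_closure_subset isClosed_singleton.isOpen_compl hne'
          exact hU' (subset_closure (hx' _ ⟨hU, U, rfl⟩)) rfl
        · rintro _ rfl t ht
          exact ht.1
      rw [image_image]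
      simp [hS]

/-- The morphism `(g^*, f⁻¹)` of de Vries extensions. -/
def EMap {e e' : Compactification.{u}} (φ : Compactification.Hom e e') :
    DeVriesExtension.Hom (EObj e') (EObj e) where
  ρ := upperStarMap φ.g
  σ := CompleteLatticeHom.setPreimage φ.f
  comm := fun U : RO e'.Y => by
    have hcomm : φ.f ⁻¹' (e'.e ⁻¹' U.carrier) = e.e ⁻¹' (φ.g ⁻¹' U.carrier) := by
      ext x
      simp only [mem_preimage, φ.comm]
    change φ.f ⁻¹' (e'.e ⁻¹' U.carrier) = starFun (preimageHom e) (upperStarMap φ.g) U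
    rw [hcomm]
    apply le_antisymm
    · intro x hx
      obtain ⟨V, hV, hVU⟩ := RO.exists_mem_closure_subset U.isOpen hx
      have hle := le_starFun (preimageHom e) (upperStarMap φ.g) (a := V) (b := U) hVU
      exact hle (preimage_subset_reg φ.g V hV)
    · refine starFun_le _ _ fun (V : RO e'.Y) (hV : closure V.carrier ⊆ U.carrier) => ?_
      exact preimage_mono (reg_preimage_subset φ.g hV)

/-- The contravariant functor `E`, sending `e : X → Y` to `e⁻¹ : RO(Y) → ℘(X)` and `(f, g)` to
`(g^*, f⁻¹)`. -/
def E : Compactification.{u}ᵒᵖ ⥤ DeVriesExtension.{u} where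
  obj e := EObj e.unop
  map φ := EMap φ.unop
  map_id _ := DeVriesExtension.Hom.ext upperStarMap_id rfl
  map_comp φ ψ := DeVriesExtension.Hom.ext (upperStarMap_comp ψ.unop.g φ.unop.g) rfl

/-! ### Ends -/

/-- `⇑ S`, the set of elements having some element of `S` proximal to them. -/
def upProx (A : DeVriesAlgebra.{u}) (S : Set A) : Set A := {a | ∃ b ∈ S, A.prox b a}

/-- A proper round filter of a de Vries algebra. -/
structure IsProperRoundFilter (A : DeVriesAlgebra.{u}) (F : Set A) : Prop where
  top_mem : ⊤ ∈ F
  inf_mem : ∀ {a b : A}, a ∈ F → b ∈ F → a ⊓ b ∈ F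
  mem_of_le : ∀ {a b : A}, a ∈ F → a ≤ b → b ∈ F
  bot_notMem : ⊥ ∉ F
  round : upProx A F = F

/-- An end: a maximal proper round filter. -/
def IsEnd (A : DeVriesAlgebra.{u}) (F : Set A) : Prop := Maximal (IsProperRoundFilter A) F

/-- The set `Y_𝔄` of ends of `𝔄`. -/
def Ends (A : DeVriesAlgebra.{u}) : Type u := {F : Set A // IsEnd A F}

/-- `ζ(a)`, the set of ends that contain `a`. -/
def zeta (A : DeVriesAlgebra.{u}) (a : A) : Set (Ends A) := {x | a ∈ x.1}

/-- The topology on the set of ends that has the sets `ζ(a)` as a basis (they are closed under finite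
intersections). -/
instance (A : DeVriesAlgebra.{u}) : TopologicalSpace (Ends A) :=
  TopologicalSpace.generateFrom (Set.range (zeta A))

section

variable {A B C : DeVriesAlgebra.{u}}

theorem IsProperRoundFilter.exists_prox {F : Set A} (hF : IsProperRoundFilter A F) {a : A}
    (ha : a ∈ F) : ∃ b ∈ F, A.prox b a := by
  rw [← hF.round] at ha
  exact ha

theorem IsProperRoundFilter.notMem_compl {F : Set A} (hF : IsProperRoundFilter A F) {a : A}
    (ha : a ∈ F) : aᶜ ∉ F := fun h => hF.bot_notMem (by
  have := hF.inf_mem ha h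
  rwa [inf_compl_eq_bot] at this)

/-- A proper round filter containing `¬ a` or `b` whenever `a ≺ b` is an end. -/
theorem isEnd_of_prime {F : Set A} (hF : IsProperRoundFilter A F)
    (h : ∀ a b : A, A.prox a b → aᶜ ∈ F ∨ b ∈ F) : IsEnd A F := by
  refine ⟨hF, fun G hG hFG x hx => ?_⟩
  obtain ⟨y, hy, hyx⟩ := hG.exists_prox hx
  rcases h y x hyx with h1 | h1
  · exact absurd (hFG h1) (hG.notMem_compl hy)
  · exact h1

theorem IsEnd.prime {F : Set A} (hF : IsEnd A F) {a b : A} (hab : A.prox a b) :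
    aᶜ ∈ F ∨ b ∈ F := by
  by_contra hcon
  rw [not_or] at hcon
  obtain ⟨hna, hnb⟩ := hcon
  let G : Set A := {x | ∃ f ∈ F, ∃ d, A.prox a d ∧ f ⊓ d ≤ x}
  have hG : IsProperRoundFilter A G :=
    { top_mem := ⟨⊤, hF.1.top_mem, ⊤, prox_top a, le_top⟩
      inf_mem := by
        rintro x y ⟨f, hf, d, hd, hx⟩ ⟨f', hf', d', hd', hy⟩
        refine ⟨f ⊓ f', hF.1.inf_mem hf hf', d ⊓ d', A.isProx.inf_right hd hd', ?_⟩
        rw [inf_inf_inf_comm]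
        exact inf_le_inf hx hy
      mem_of_le := by
        rintro x y ⟨f, hf, d, hd, hx⟩ hxy
        exact ⟨f, hf, d, hd, hx.trans hxy⟩
      bot_notMem := by
        rintro ⟨f, hf, d, hd, hx⟩
        have hfd : f ≤ dᶜ := by
          rw [le_compl_iff_disjoint_right, disjoint_iff]
          exact le_bot_iff.1 hx
        exact hna (hF.1.mem_of_le hf
          (hfd.trans (A.isProx.le_of_prox (A.isProx.compl hd))))
      round := by
        apply Subset.antisymm
        · rintro y ⟨x, ⟨f, hf, d, hd, hx⟩, hxy⟩
          exact ⟨f, hf, d, hd, hx.trans (A.isProx.le_of_prox hxy)⟩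
        · rintro x ⟨f, hf, d, hd, hx⟩
          obtain ⟨f', hf', hff⟩ := hF.1.exists_prox hf
          obtain ⟨d', had, hdd⟩ := A.isProx.interpolate hd
          exact ⟨f' ⊓ d', ⟨f', hf', d', had, le_rfl⟩,
            A.isProx.mono le_rfl (prox_inf_inf hff hdd) hx⟩ }
  have hFG : F ≤ G := fun f hf => ⟨f, hf, ⊤, prox_top a, inf_le_left⟩
  exact hnb (hF.2 hG hFG ⟨⊤, hF.1.top_mem, b, hab, inf_le_right⟩)

theorem Ends.eq_of_subset {x y : Ends A} (h : x.1 ⊆ y.1) : x = y :=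
  Subtype.ext (Subset.antisymm h (x.2.2 y.2.1 h))

theorem isOpen_zeta (a : A) : IsOpen (zeta A a) :=
  TopologicalSpace.isOpen_generateFrom_of_mem ⟨a, rfl⟩

theorem zeta_mono {a b : A} (h : a ≤ b) : zeta A a ⊆ zeta A b :=
  fun x hx => x.2.1.mem_of_le hx h

instance (A : DeVriesAlgebra.{u}) : CompactSpace (Ends A) := by
  refine ⟨isCompact_iff_ultrafilter_le_nhds.2 fun 𝒰 _ => ?_⟩
  let F : Set A := {a | ∃ b, A.prox b a ∧ zeta A b ∈ 𝒰}
  have hF : IsProperRoundFilter A F :=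
    { top_mem := by
        refine ⟨⊤, A.isProx.top_top, ?_⟩
        have : zeta A ⊤ = univ := eq_univ_of_forall fun x => x.2.1.top_mem
        rw [this]
        exact Filter.univ_mem
      inf_mem := by
        rintro x y ⟨b, hb, hb'⟩ ⟨c, hc, hc'⟩
        refine ⟨b ⊓ c, prox_inf_inf hb hc, Filter.mem_of_superset (Filter.inter_mem hb' hc') ?_⟩
        exact fun z hz => z.2.1.inf_mem hz.1 hz.2
      mem_of_le := by
        rintro x y ⟨b, hb, hb'⟩ hxy
        exact ⟨b, A.isProx.mono le_rfl hb hxy, hb'⟩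
      bot_notMem := by
        rintro ⟨b, hb, hb'⟩
        obtain ⟨z, hz⟩ := 𝒰.nonempty_of_mem hb'
        rw [prox_bot hb] at hz
        exact z.2.1.bot_notMem hz
      round := by
        apply Subset.antisymm
        · rintro y ⟨x, ⟨b, hb, hb'⟩, hxy⟩
          exact ⟨b, prox_trans hb hxy, hb'⟩
        · rintro x ⟨b, hb, hb'⟩
          obtain ⟨c, hbc, hcx⟩ := A.isProx.interpolate hb
          exact ⟨c, ⟨b, hbc, hb'⟩, hcx⟩ }
  have hend : IsEnd A F := by
    refine isEnd_of_prime hF fun a b hab => ?_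
    obtain ⟨c, hac, hcb⟩ := A.isProx.interpolate hab
    obtain ⟨d, hcd, hdb⟩ := A.isProx.interpolate hcb
    have hcov : zeta A cᶜ ∪ zeta A d ∈ 𝒰 := by
      have : zeta A cᶜ ∪ zeta A d = univ := eq_univ_of_forall fun x => x.2.prime hcd
      rw [this]
      exact Filter.univ_mem
    rcases Ultrafilter.union_mem_iff.1 hcov with h | h
    · exact Or.inl ⟨cᶜ, A.isProx.compl hac, h⟩
    · exact Or.inr ⟨d, hdb, h⟩
  let z : Ends A := ⟨F, hend⟩
  refine ⟨z, mem_univ _, ?_⟩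
  rw [TopologicalSpace.nhds_generateFrom]
  refine le_iInf₂ ?_
  rintro s ⟨hs, ⟨a, rfl⟩⟩
  obtain ⟨b, hb, hb'⟩ : a ∈ F := hs
  exact Filter.le_principal_iff.2 (Filter.mem_of_superset hb' (zeta_mono (A.isProx.le_of_prox hb)))

instance (A : DeVriesAlgebra.{u}) : T2Space (Ends A) := by
  refine ⟨fun x y hxy => ?_⟩
  have hns : ¬ x.1 ⊆ y.1 := fun h => hxy (Ends.eq_of_subset h)
  obtain ⟨a, hax, hay⟩ := not_subset.1 hns
  obtain ⟨b, hbx, hba⟩ := x.2.1.exists_prox hax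
  rcases y.2.prime hba with h | h
  · refine ⟨zeta A b, zeta A bᶜ, isOpen_zeta b, isOpen_zeta _, hbx, h, ?_⟩
    rw [disjoint_left]
    exact fun z hz hz' => z.2.1.notMem_compl hz hz'
  · exact absurd h hay

theorem isEnd_upProx (ρ : DeVriesHom A B) (y : Ends B) :
    IsEnd A (upProx A (ρ.toFun ⁻¹' y.1)) := by
  have hF : IsProperRoundFilter A (upProx A (ρ.toFun ⁻¹' y.1)) :=
    { top_mem := ⟨⊤, by rw [mem_preimage, ρ.map_top]; exact y.2.1.top_mem, A.isProx.top_top⟩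
      inf_mem := by
        rintro a b ⟨c, hc, hca⟩ ⟨d, hd, hdb⟩
        refine ⟨c ⊓ d, ?_, prox_inf_inf hca hdb⟩
        rw [mem_preimage, ρ.map_inf]
        exact y.2.1.inf_mem hc hd
      mem_of_le := by
        rintro a b ⟨c, hc, hca⟩ hab
        exact ⟨c, hc, A.isProx.mono le_rfl hca hab⟩
      bot_notMem := by
        rintro ⟨c, hc, hc0⟩
        rw [prox_bot hc0, mem_preimage, ρ.map_bot] at hc
        exact y.2.1.bot_notMem hc
      round := by
        apply Subset.antisymm
        · rintro b ⟨a, ⟨c, hc, hca⟩, hab⟩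
          exact ⟨c, hc, prox_trans hca hab⟩
        · rintro a ⟨c, hc, hca⟩
          obtain ⟨d, hcd, hda⟩ := A.isProx.interpolate hca
          exact ⟨d, ⟨c, hc, hcd⟩, hda⟩ }
  refine isEnd_of_prime hF fun a b hab => ?_
  obtain ⟨c, hac, hcb⟩ := A.isProx.interpolate hab
  obtain ⟨d, hcd, hdb⟩ := A.isProx.interpolate hcb
  rcases y.2.prime (ρ.map_prox c d hcd) with h | h
  · rw [compl_compl] at h
    exact Or.inl ⟨cᶜ, h, A.isProx.compl hac⟩
  · exact Or.inr ⟨d, h, hdb⟩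

/-- The map `ρ_* : Y_𝔅 → Y_𝔄`, `ρ_* y = ⇑ ρ⁻¹(y)`, dual to a de Vries morphism `ρ : 𝔄 → 𝔅`. -/
def lowerStar (ρ : DeVriesHom A B) (y : Ends B) : Ends A :=
  ⟨upProx A (ρ.toFun ⁻¹' y.1), isEnd_upProx ρ y⟩

theorem continuous_lowerStar (ρ : DeVriesHom A B) : Continuous (lowerStar ρ) := by
  refine continuous_generateFrom_iff.2 ?_
  rintro _ ⟨a, rfl⟩
  have : lowerStar ρ ⁻¹' zeta A a = ⋃ b ∈ {b : A | A.prox b a}, zeta B (ρ b) := by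
    ext y
    simp only [mem_iUnion]
    constructor
    · rintro ⟨b, hb, hba⟩
      exact ⟨b, hba, hb⟩
    · rintro ⟨b, hba, hb⟩
      exact ⟨b, hb, hba⟩
  rw [this]
  exact isOpen_biUnion fun b _ => isOpen_zeta _

theorem lowerStar_idHom (y : Ends A) : lowerStar (idHom A) y = y :=
  Subtype.ext y.2.1.round

theorem lowerStar_star (ρ₂ : DeVriesHom B C) (ρ₁ : DeVriesHom A B) (y : Ends C) :
    lowerStar (star ρ₂ ρ₁) y = lowerStar ρ₁ (lowerStar ρ₂ y) := by
  refine (Ends.eq_of_subset ?_).symm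
  rintro a ⟨b, ⟨c, hc, hcb⟩, hba⟩
  obtain ⟨d, hbd, hda⟩ := A.isProx.interpolate hba
  refine ⟨d, y.2.1.mem_of_le hc ?_, hda⟩
  exact (ρ₂.monotone (B.isProx.le_of_prox hcb)).trans (le_starFun ρ₂ ρ₁ hbd)

end

/-! ### The functor `C` -/

section

variable {B B' B'' : Type u} [CompleteBooleanAlgebra B] [CompleteBooleanAlgebra B']
  [CompleteBooleanAlgebra B'']

theorem atom_le_or_le_compl {x : B} (hx : IsAtom x) (b : B) : x ≤ b ∨ x ≤ bᶜ := by
  by_cases h : x ≤ b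
  · exact Or.inl h
  · exact Or.inr (le_compl_iff_disjoint_right.2 (hx.not_le_iff_disjoint.1 h))

theorem isEnd_atom {x : B} (hx : IsAtom x) : IsEnd (extremallyDisconnected B) (Set.Ici x) := by
  refine isEnd_of_prime
    { top_mem := le_top (a := x)
      inf_mem := fun ha hb => le_inf (α := B) ha hb
      mem_of_le := fun ha hab => le_trans (α := B) ha hab
      bot_notMem := fun h => hx.1 (le_bot_iff.1 h)
      round := ?_ } ?_
  · apply Subset.antisymm
    · rintro b ⟨a, ha, hab⟩
      exact le_trans (α := B) ha hab
    · exact fun b hb => ⟨b, hb, le_refl (α := B) b⟩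
  · intro (a : B) (b : B) (hab : a ≤ b)
    rcases atom_le_or_le_compl hx a with h | h
    · exact Or.inr (h.trans hab)
    · exact Or.inl h

/-- The principal ultrafilter `↑x` of an atom `x`, as an end of `(B, ≤)`. -/
def atomEnd (x : {x : B // IsAtom x}) : Ends (extremallyDisconnected B) :=
  ⟨Set.Ici x.1, isEnd_atom x.2⟩

theorem le_map_sInf (σ : CompleteLatticeHom B B') (x : B') :
    x ≤ σ (sInf {b : B | x ≤ σ b}) := by
  rw [map_sInf]
  refine le_sInf ?_
  rintro _ ⟨b, hb, rfl⟩
  exact hb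

theorem sInf_le_iff_le_map (σ : CompleteLatticeHom B B') (x : B') (b : B) :
    sInf {b : B | x ≤ σ b} ≤ b ↔ x ≤ σ b :=
  ⟨fun h => (le_map_sInf σ x).trans (OrderHomClass.mono σ h), fun h => sInf_le h⟩

theorem isAtom_sInf (σ : CompleteLatticeHom B B') {x : B'} (hx : IsAtom x) :
    IsAtom (sInf {b : B | x ≤ σ b}) := by
  constructor
  · intro h
    have := le_map_sInf σ x
    rw [h, map_bot] at this
    exact hx.1 (le_bot_iff.1 this)
  · intro c hc
    rcases atom_le_or_le_compl hx (σ c) with h | h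
    · exact absurd ((sInf_le_iff_le_map σ x c).2 h) hc.not_ge
    · rw [← map_compl'] at h
      have h1 := hc.le.trans ((sInf_le_iff_le_map σ x cᶜ).2 h)
      rw [le_compl_iff_disjoint_right, disjoint_self] at h1
      exact h1

/-- The map `σ_+` from the atoms of `B'` to the atoms of `B`, `σ_+ x = ⋀ {b | x ≤ σ b}`, dual to a
complete Boolean homomorphism `σ : B → B'`. -/
def lowerPlus (σ : CompleteLatticeHom B B') (x : {x : B' // IsAtom x}) : {x : B // IsAtom x} :=
  ⟨sInf {b : B | x.1 ≤ σ b}, isAtom_sInf σ x.2⟩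

end

namespace DeVriesExtension

/-- The set `X_𝔅` of atoms of `B`, for a de Vries extension `α : 𝔄 → 𝔅 = (B, ≤)`. -/
def AtomSpace (a : DeVriesExtension.{u}) : Type u := {x : a.B // IsAtom x}

/-- The restriction of `α_*` to the atoms. -/
def atomMap (a : DeVriesExtension.{u}) (x : a.AtomSpace) : Ends a.A := lowerStar a.α (atomEnd x)

/-- The least topology on the set of atoms that makes `α_*` continuous. -/
instance (a : DeVriesExtension.{u}) : TopologicalSpace a.AtomSpace :=
  TopologicalSpace.induced a.atomMap inferInstance

theorem mem_atomMap (a : DeVriesExtension.{u}) (x : a.AtomSpace) (b : a.A) :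
    b ∈ (a.atomMap x).1 ↔ x.1 ≤ a.α b := by
  constructor
  · rintro ⟨c, hc, hcb⟩
    exact le_trans (α := a.B) hc (a.α.monotone (a.A.isProx.le_of_prox hcb))
  · intro h
    by_contra hcon
    have hle : a.α b ≤ x.1ᶜ := by
      rw [a.α.map_sSup b]
      refine sSup_le (α := a.B) ?_
      rintro _ ⟨c, hc, rfl⟩
      rcases atom_le_or_le_compl x.2 (a.α c) with h' | h'
      · exact (hcon ⟨c, h', hc⟩).elim
      · exact le_compl_comm.1 h'
    have h1 : x.1 ≤ x.1ᶜ := le_trans (α := a.B) h hle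
    rw [le_compl_iff_disjoint_right, disjoint_self] at h1
    exact x.2.1 h1

theorem atomMap_injective (a : DeVriesExtension.{u}) : Function.Injective a.atomMap := by
  intro x y hxy
  have key : ∀ b : a.A, x.1 ≤ a.α b → y.1 ≤ a.α b := fun b hb => by
    rw [← mem_atomMap, ← hxy, mem_atomMap]
    exact hb
  obtain ⟨𝒮, h𝒮, hx⟩ := a.joinMeetDense x.1
  have hex : ∃ S ∈ 𝒮, x.1 ≤ sInf S := by
    by_contra hcon
    have hle : x.1 ≤ x.1ᶜ := by
      refine hx.le.trans (sSup_le ?_)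
      rintro _ ⟨S, hS, rfl⟩
      rcases atom_le_or_le_compl x.2 (sInf S) with h | h
      · exact absurd ⟨S, hS, h⟩ hcon
      · exact le_compl_comm.1 h
    rw [le_compl_iff_disjoint_right, disjoint_self] at hle
    exact x.2.1 hle
  obtain ⟨S, hS, hxS⟩ := hex
  have hyS : y.1 ≤ sInf S := le_sInf fun s hs => by
    obtain ⟨b, rfl⟩ := h𝒮 S hS hs
    exact key b (hxS.trans (sInf_le hs))
  have hSx : sInf S ≤ x.1 := le_trans (le_sSup (mem_image_of_mem _ hS)) hx.ge
  have hyx : y.1 ≤ x.1 := hyS.trans hSx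
  exact Subtype.ext (((x.2.le_iff).1 hyx).resolve_left y.2.1).symm

theorem isEmbedding_atomMap (a : DeVriesExtension.{u}) : IsEmbedding a.atomMap :=
  ⟨⟨rfl⟩, a.atomMap_injective⟩

theorem isTopologicalBasis_zeta (A : DeVriesAlgebra.{u}) :
    TopologicalSpace.IsTopologicalBasis (Set.range (zeta A)) where
  exists_subset_inter := by
    rintro _ ⟨a, rfl⟩ _ ⟨b, rfl⟩ x hx
    refine ⟨zeta A (a ⊓ b), ⟨_, rfl⟩, x.2.1.inf_mem hx.1 hx.2, ?_⟩
    exact subset_inter (zeta_mono inf_le_left) (zeta_mono inf_le_right)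
  sUnion_eq := eq_univ_of_forall fun x => ⟨zeta A ⊤, ⟨_, rfl⟩, x.2.1.top_mem⟩
  eq_generateFrom := rfl

theorem denseRange_atomMap (a : DeVriesExtension.{u}) : DenseRange a.atomMap := by
  refine (isTopologicalBasis_zeta a.A).dense_iff.2 ?_
  rintro _ ⟨b, rfl⟩ ⟨y, hy⟩
  have hb : a.α b ≠ (⊥ : a.B) := fun h => by
    have h0 : b = ⊥ := a.injective (h.trans a.α.map_bot.symm)
    rw [h0] at hy
    exact y.2.1.bot_notMem hy
  obtain ⟨x, hx, hxb⟩ := (IsAtomic.eq_bot_or_exists_atom_le (a.α b : a.B)).resolve_left hb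
  exact ⟨a.atomMap ⟨x, hx⟩, (a.mem_atomMap ⟨x, hx⟩ b).2 hxb, ⟨x, hx⟩, rfl⟩

instance (a : DeVriesExtension.{u}) : T35Space a.AtomSpace := a.isEmbedding_atomMap.t35Space

end DeVriesExtension

/-- The compactification `α_* : X_𝔅 → Y_𝔄` of a de Vries extension `α : 𝔄 → 𝔅`. -/
def CObj (a : DeVriesExtension.{u}) : Compactification.{u} where
  X := a.AtomSpace
  Y := Ends a.A
  e := a.atomMap
  isEmbedding := a.isEmbedding_atomMap
  denseRange := a.denseRange_atomMap

theorem atomMap_lowerPlus {a a' : DeVriesExtension.{u}} (φ : DeVriesExtension.Hom a a')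
    (x : a'.AtomSpace) : lowerStar φ.ρ (a'.atomMap x) = a.atomMap (lowerPlus φ.σ x) := by
  have h : lowerStar φ.ρ (a'.atomMap x) = lowerStar (star a'.α φ.ρ) (atomEnd x) :=
    (lowerStar_star a'.α φ.ρ (atomEnd x)).symm
  rw [h]
  refine Ends.eq_of_subset ?_
  rintro b ⟨c, hc, hcb⟩
  refine ⟨c, ?_, hcb⟩
  change x.1 ≤ star a'.α φ.ρ c at hc
  rw [← φ.comm c] at hc
  exact (sInf_le_iff_le_map φ.σ x.1 (a.α c)).2 hc

/-- The morphism `(σ_+, ρ_*)` of compactifications. -/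
def CMap {a a' : DeVriesExtension.{u}} (φ : DeVriesExtension.Hom a a') :
    Compactification.Hom (CObj a') (CObj a) where
  f := ⟨(lowerPlus φ.σ : a'.AtomSpace → a.AtomSpace), by
    refine continuous_induced_rng.2 ?_
    have hc : Continuous (lowerStar φ.ρ ∘ a'.atomMap) :=
      (continuous_lowerStar φ.ρ).comp continuous_induced_dom
    exact hc.congr fun x => atomMap_lowerPlus φ x⟩
  g := ⟨lowerStar φ.ρ, continuous_lowerStar φ.ρ⟩
  comm := fun x => atomMap_lowerPlus φ x

/-- The contravariant functor `C`, sending `α : 𝔄 → 𝔅` to `α_* : X_𝔅 → Y_𝔄` and `(ρ, σ)` to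
`(σ_+, ρ_*)`. -/
def C : DeVriesExtension.{u}ᵒᵖ ⥤ Compactification.{u} where
  obj a := CObj a.unop
  map φ := CMap φ.unop
  map_id a := by
    refine Compactification.Hom.ext (ContinuousMap.ext fun x => ?_)
      (ContinuousMap.ext fun y => lowerStar_idHom y)
    exact Subtype.ext (le_antisymm (sInf_le (le_refl x.1)) (le_sInf fun _ hb => hb))
  map_comp {a₁ a₂ a₃} φ ψ := by
    refine Compactification.Hom.ext (ContinuousMap.ext fun x => ?_)
      (ContinuousMap.ext fun y => lowerStar_star φ.unop.ρ ψ.unop.ρ y)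
    refine Subtype.ext ?_
    change sInf {b | x.1 ≤ φ.unop.σ (ψ.unop.σ b)} =
      sInf {b | sInf {c | x.1 ≤ φ.unop.σ c} ≤ ψ.unop.σ b}
    simp only [sInf_le_iff_le_map]

end DeVries

namespace DeVries

/-! ### The representation of a de Vries algebra by regular open sets of ends -/

section

variable {A A' : DeVriesAlgebra.{u}}

/-! Each side of the duality is recovered from the other by a representation, and these
representations are the two natural isomorphisms.

On the algebraic side, `a ↦ ζ(a)` identifies `𝔄` with the regular open sets of its space of ends. By
Zorn's lemma every nonzero element lies in an end (`zeta_nonempty`). Hence `ζ` reflects the order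
(`zeta_subset_zeta`), and the closure of `ζ(a)` is the complement of `ζ(¬a)` (`closure_zeta`), so
`ζ(a)` is regular open. Completeness of `A` makes `ζ` surjective, while primeness of ends and
compactness of the space of ends turn `≺` into inclusion of closures
(`prox_iff_closure_zeta_subset`). A complete atomic `B` is the powerset of its atoms, and
`mem_atomMap` says exactly that the two identifications commute with `α`.

On the topological side, sending a point of `Y` to its regular open neighbourhoods is continuous and
injective with dense image, from a compact space to a Hausdorff one, hence a homeomorphism. The
atoms of `℘(X)` are the singletons. Since `X` carries the topology induced from `Y`, bijectivity of
both components already gives an isomorphism of compactifications.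

The operation `⋆` is not composition of functions, but it is so when one factor is an order
isomorphism that preserves and reflects proximity. Naturality on the algebraic side thus reduces to
a pointwise identity (`reg_lowerStar_preimage_zeta`). -/

theorem sup_prox {a b c : A} (h₁ : A.prox a c) (h₂ : A.prox b c) : A.prox (a ⊔ b) c := by
  have h := A.isProx.compl (A.isProx.inf_right (A.isProx.compl h₁) (A.isProx.compl h₂))
  simpa only [compl_inf, compl_compl] using h

/-- The elements above which some fixed element is proximal form a round filter. -/
theorem isProperRoundFilter_upProx_singleton {c : A} (hc : c ≠ ⊥) :
    IsProperRoundFilter A (upProx A {c}) where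
  top_mem := ⟨c, rfl, prox_top c⟩
  inf_mem := by
    rintro a b ⟨_, rfl, ha⟩ ⟨_, rfl, hb⟩
    exact ⟨_, rfl, A.isProx.inf_right ha hb⟩
  mem_of_le := by
    rintro a b ⟨_, rfl, ha⟩ hab
    exact ⟨_, rfl, A.isProx.mono le_rfl ha hab⟩
  bot_notMem := by
    rintro ⟨_, rfl, h⟩
    exact hc (prox_bot h)
  round := by
    apply Subset.antisymm
    · rintro b ⟨a, ⟨_, rfl, ha⟩, hab⟩
      exact ⟨_, rfl, prox_trans ha hab⟩
    · rintro b ⟨_, rfl, hb⟩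
      obtain ⟨d, hcd, hdb⟩ := A.isProx.interpolate hb
      exact ⟨d, ⟨_, rfl, hcd⟩, hdb⟩

/-- The upper bound for Zorn's lemma. Nonemptiness of the chain supplies `⊤`; the chain condition is
needed only for meets. -/
theorem isProperRoundFilter_sUnion {c : Set (Set A)} (hc : ∀ F ∈ c, IsProperRoundFilter A F)
    (hchain : IsChain (· ⊆ ·) c) (hne : c.Nonempty) : IsProperRoundFilter A (⋃₀ c) where
  top_mem := hne.elim fun F hF => ⟨F, hF, (hc F hF).top_mem⟩
  inf_mem := by
    rintro a b ⟨F, hF, ha⟩ ⟨G, hG, hb⟩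
    rcases hchain.total hF hG with h | h
    · exact ⟨G, hG, (hc G hG).inf_mem (h ha) hb⟩
    · exact ⟨F, hF, (hc F hF).inf_mem ha (h hb)⟩
  mem_of_le := by
    rintro a b ⟨F, hF, ha⟩ hab
    exact ⟨F, hF, (hc F hF).mem_of_le ha hab⟩
  bot_notMem := by
    rintro ⟨F, hF, h⟩
    exact (hc F hF).bot_notMem h
  round := by
    apply Subset.antisymm
    · rintro b ⟨a, ⟨F, hF, ha⟩, hab⟩
      exact ⟨F, hF, (hc F hF).mem_of_le ha (A.isProx.le_of_prox hab)⟩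
    · rintro b ⟨F, hF, hb⟩
      obtain ⟨a, ha, hab⟩ := (hc F hF).exists_prox hb
      exact ⟨a, ⟨F, hF, ha⟩, hab⟩

theorem IsProperRoundFilter.exists_isEnd {F : Set A} (hF : IsProperRoundFilter A F) :
    ∃ y : Ends A, F ⊆ y.1 := by
  obtain ⟨m, hFm, hm⟩ := zorn_subset_nonempty {G | IsProperRoundFilter A G}
    (fun c hcS hc hne => ⟨⋃₀ c, isProperRoundFilter_sUnion hcS hc hne,
      fun _ => subset_sUnion_of_mem⟩) F hF
  exact ⟨⟨m, hm⟩, hFm⟩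

/-- The last proximity axiom gives a nonzero `c ≺ a`. Then `⇑{c}` is a proper round filter that
contains `a`, and it extends to an end. -/
theorem zeta_nonempty {a : A} (ha : a ≠ ⊥) : (zeta A a).Nonempty := by
  obtain ⟨c, hc, hca⟩ := A.isProx.exists_prox ha
  obtain ⟨y, hy⟩ := (isProperRoundFilter_upProx_singleton hc).exists_isEnd
  exact ⟨y, hy ⟨c, rfl, hca⟩⟩

theorem zeta_inf (a b : A) : zeta A (a ⊓ b) = zeta A a ∩ zeta A b :=
  Subset.antisymm (subset_inter (zeta_mono inf_le_left) (zeta_mono inf_le_right))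
    fun y hy => y.2.1.inf_mem hy.1 hy.2

/-- If `a ≰ b`, then some end contains the nonzero element `a ⊓ bᶜ`; it contains `a` and cannot
contain `b`. -/
theorem zeta_subset_zeta {a b : A} : zeta A a ⊆ zeta A b ↔ a ≤ b := by
  refine ⟨fun h => ?_, zeta_mono⟩
  by_contra hab
  have hne : a ⊓ bᶜ ≠ ⊥ := fun h0 => hab (by
    rwa [← disjoint_iff, disjoint_compl_right_iff] at h0)
  obtain ⟨y, hy⟩ := zeta_nonempty hne
  rw [zeta_inf] at hy
  exact y.2.1.notMem_compl (h hy.1) hy.2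

theorem exists_zeta_subset {y : Ends A} {O : Set (Ends A)} (hO : IsOpen O) (hy : y ∈ O) :
    ∃ a, y ∈ zeta A a ∧ zeta A a ⊆ O := by
  obtain ⟨_, ⟨a, rfl⟩, ha, haO⟩ :=
    (DeVriesExtension.isTopologicalBasis_zeta A).exists_subset_of_mem_open hy hO
  exact ⟨a, ha, haO⟩

/-- A basic neighbourhood `ζ(b)` of an end misses `ζ(a)` only if `b ⊓ a = ⊥`, that is `b ≤ aᶜ`, and
then the end lies in `ζ(aᶜ)`. -/
theorem closure_zeta (a : A) : closure (zeta A a) = (zeta A aᶜ)ᶜ := by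
  apply Subset.antisymm
  · exact closure_minimal (fun y hy => y.2.1.notMem_compl hy) (isOpen_zeta _).isClosed_compl
  · intro y hy
    refine mem_closure_iff.2 fun O hO hyO => ?_
    obtain ⟨b, hyb, hbO⟩ := exists_zeta_subset hO hyO
    have hne : b ⊓ a ≠ ⊥ := fun h =>
      hy (zeta_mono (le_compl_iff_disjoint_right.2 (disjoint_iff.2 h)) hyb)
    obtain ⟨z, hz⟩ := zeta_nonempty hne
    rw [zeta_inf] at hz
    exact ⟨z, hbO hz.1, hz.2⟩

theorem interior_closure_zeta (a : A) : interior (closure (zeta A a)) = zeta A a := by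
  rw [closure_zeta, interior_compl, closure_zeta, compl_compl, compl_compl]

/-- Forwards, this is primeness of ends. Backwards, roundness covers the compact set `cl ζ(a)` by
the sets `ζ(c)` with `c ≺ b`. This family is directed because such `c` are closed under joins, so a
single `c` suffices, and `a ≤ c ≺ b`. -/
theorem prox_iff_closure_zeta_subset {a b : A} : A.prox a b ↔ closure (zeta A a) ⊆ zeta A b := by
  constructor
  · intro h y hy
    rw [closure_zeta] at hy
    exact (y.2.prime h).resolve_left hy
  · intro h
    -- A directed cover needs a nonempty index set; `⊥ ≺ b` provides it even when `b = ⊥`.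
    have : Nonempty {c : A // A.prox c b} := ⟨⟨⊥, bot_prox b⟩⟩
    obtain ⟨⟨c, hcb⟩, hc⟩ := isClosed_closure.isCompact.elim_directed_cover
      (fun c : {c : A // A.prox c b} => zeta A c.1) (fun c => isOpen_zeta c.1)
      (fun y hy => by
        obtain ⟨c, hc, hcb⟩ := y.2.1.exists_prox (h hy)
        exact mem_iUnion.2 ⟨⟨c, hcb⟩, hc⟩)
      (fun c d => ⟨⟨c.1 ⊔ d.1, sup_prox c.2 d.2⟩, zeta_mono le_sup_left, zeta_mono le_sup_right⟩)
    exact A.isProx.mono (zeta_subset_zeta.1 (subset_closure.trans hc)) hcb le_rfl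

/-- `ζ(a)`, as a regular open set of ends. -/
def zetaRO (A : DeVriesAlgebra.{u}) (a : A) : RO (Ends A) := ⟨zeta A a, interior_closure_zeta a⟩

/-- The preimage of `U` is the join of all `a` with `ζ(a) ⊆ U`. As `U` is the interior of its
closure, it is enough that ends containing this join are adherent to `U`; that follows from
distributivity of finite meets over arbitrary joins. -/
theorem zetaRO_surjective : Function.Surjective (zetaRO A) := by
  intro U
  refine ⟨sSup {a | zeta A a ⊆ U.carrier}, RO.ext (Subset.antisymm ?_ ?_)⟩
  · conv_rhs => rw [← U.regular]
    refine interior_maximal (fun y hy => mem_closure_iff.2 fun O hO hyO => ?_) (isOpen_zeta _)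
    obtain ⟨b, hyb, hbO⟩ := exists_zeta_subset hO hyO
    have hne : b ⊓ sSup {a | zeta A a ⊆ U.carrier} ≠ ⊥ := fun h =>
      y.2.1.bot_notMem (h ▸ y.2.1.inf_mem hyb hy)
    -- If `b` were disjoint from every such `a`, it would be disjoint from their join.
    obtain ⟨a, ha, hba⟩ : ∃ a, zeta A a ⊆ U.carrier ∧ b ⊓ a ≠ ⊥ := by
      by_contra! hcon
      refine hne ?_
      rw [inf_sSup_eq]
      exact le_bot_iff.1 (iSup₂_le fun a ha => (hcon a ha).le)
    obtain ⟨z, hz⟩ := zeta_nonempty hba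
    rw [zeta_inf] at hz
    exact ⟨z, hbO hz.1, ha hz.2⟩
  · intro y hy
    obtain ⟨a, hya, haU⟩ := exists_zeta_subset U.isOpen hy
    exact zeta_mono (le_sSup haU) hya

/-- The isomorphism `a ↦ ζ(a)` from `𝔄` onto the regular open sets of its space of ends. -/
noncomputable def zetaIso (A : DeVriesAlgebra.{u}) : A ≃o RO (Ends A) where
  toEquiv := Equiv.ofBijective (zetaRO A)
    ⟨fun _ _ h => le_antisymm (zeta_subset_zeta.1 (congrArg RO.carrier h).subset)
      (zeta_subset_zeta.1 (congrArg RO.carrier h).superset), zetaRO_surjective⟩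
  map_rel_iff' := zeta_subset_zeta

theorem prox_iff_zetaIso (a b : A) :
    A.prox a b ↔ (upperStar (Ends A)).prox (zetaIso A a) (zetaIso A b) :=
  prox_iff_closure_zeta_subset

theorem lowerStar_preimage_zeta (ρ : DeVriesHom A A') (a : A) :
    lowerStar ρ ⁻¹' zeta A a = ⋃ b ∈ {b : A | A.prox b a}, zeta A' (ρ b) := by
  ext y
  simp only [mem_iUnion]
  exact ⟨fun ⟨b, hb, hba⟩ => ⟨b, hba, hb⟩, fun ⟨b, hba, hb⟩ => ⟨b, hb, hba⟩⟩

/-- `ρ a` is the join of the `ρ b` with `b ≺ a`, and `ζ` carries this join to the interior of the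
closure of the union of the `ζ(ρ b)`. That union is the preimage of `ζ(a)` under `ρ_*`. This is the
pointwise form of naturality of `ζ`. -/
theorem reg_lowerStar_preimage_zeta (ρ : DeVriesHom A A') (a : A) :
    RO.reg (lowerStar ρ ⁻¹' zeta A a) = zetaIso A' (ρ a) := by
  rw [ρ.map_sSup a, OrderIso.map_sSup, ← sSup_image]
  refine RO.ext ?_
  rw [RO.carrier_sSup, lowerStar_preimage_zeta]
  change interior (closure _) = interior (closure _)
  congr 2
  ext y
  simp only [mem_iUnion]
  constructor
  · rintro ⟨b, hb, hy⟩
    exact ⟨_, ⟨_, ⟨b, hb, rfl⟩, rfl⟩, hy⟩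
  · rintro ⟨_, ⟨_, ⟨b, hb, rfl⟩, rfl⟩, hy⟩
    exact ⟨b, hb, hy⟩

end

/-! ### Isomorphisms of de Vries extensions -/

section

variable {A A' A'' : DeVriesAlgebra.{u}}

/-- An order isomorphism that preserves and reflects proximity is a de Vries morphism. -/
def DeVriesHom.ofOrderIso (θ : A ≃o A') (hθ : ∀ a b : A, A.prox a b ↔ A'.prox (θ a) (θ b)) :
    DeVriesHom A A' where
  toFun := θ
  map_bot := OrderIso.map_bot θ
  map_inf := OrderIso.map_inf θ
  map_prox := fun a b h => by
    rw [map_compl', compl_compl]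
    exact (hθ a b).1 h
  map_sSup := fun b => by
    conv_lhs => rw [eq_sSup_prox b, OrderIso.map_sSup, ← sSup_image]
    rfl

theorem prox_symm_iff {θ : A ≃o A'} (hθ : ∀ a b : A, A.prox a b ↔ A'.prox (θ a) (θ b)) (a b : A') :
    A'.prox a b ↔ A.prox (θ.symm a) (θ.symm b) := by
  rw [hθ, θ.apply_symm_apply, θ.apply_symm_apply]

/-- The elements proximal to `θ b` are exactly the `θ a` with `a ≺ b`, so the join defining `⋆` is
the one that expresses `ρ (θ b)` by the last axiom of de Vries morphisms. -/
theorem star_ofOrderIso_apply (ρ : DeVriesHom A' A'') (θ : A ≃o A')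
    (hθ : ∀ a b : A, A.prox a b ↔ A'.prox (θ a) (θ b)) (b : A) :
    star ρ (DeVriesHom.ofOrderIso θ hθ) b = ρ (θ b) := by
  rw [ρ.map_sSup (θ b)]
  change sSup _ = sSup _
  congr 1
  ext x
  constructor
  · rintro ⟨a, ha, rfl⟩
    exact ⟨θ a, (hθ a b).1 ha, rfl⟩
  · rintro ⟨c, hc, rfl⟩
    refine ⟨θ.symm c, (hθ _ _).2 (by rwa [θ.apply_symm_apply]), ?_⟩
    change ρ (θ (θ.symm c)) = ρ c
    rw [θ.apply_symm_apply]

/-- An order isomorphism preserves the join that expresses `ρ b` through the `ρ a` with `a ≺ b`. -/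
theorem ofOrderIso_star_apply (θ : A' ≃o A'')
    (hθ : ∀ a b : A', A'.prox a b ↔ A''.prox (θ a) (θ b)) (ρ : DeVriesHom A A') (b : A) :
    star (DeVriesHom.ofOrderIso θ hθ) ρ b = θ (ρ b) := by
  rw [ρ.map_sSup b, OrderIso.map_sSup, ← sSup_image]
  change sSup _ = sSup _
  congr 1
  ext x
  constructor
  · rintro ⟨a, ha, rfl⟩
    exact ⟨_, ⟨a, ha, rfl⟩, rfl⟩
  · rintro ⟨_, ⟨a, ha, rfl⟩, rfl⟩
    exact ⟨a, ha, rfl⟩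

/-- The isomorphism `a ↦ ζ(a)`, as a de Vries morphism. -/
noncomputable def zetaHom (A : DeVriesAlgebra.{u}) : DeVriesHom A (upperStar (Ends A)) :=
  DeVriesHom.ofOrderIso (A' := upperStar (Ends A)) (zetaIso A) prox_iff_zetaIso

theorem zetaHom_naturality (ρ : DeVriesHom A A') : star (zetaHom A') ρ =
    star (upperStarMap ⟨lowerStar ρ, continuous_lowerStar ρ⟩) (zetaHom A) := by
  refine DeVriesHom.ext (funext fun b => ?_)
  have h₁ := ofOrderIso_star_apply (A'' := upperStar (Ends A')) (zetaIso A') prox_iff_zetaIso ρ b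
  have h₂ := star_ofOrderIso_apply (A' := upperStar (Ends A)) (A'' := upperStar (Ends A'))
    (upperStarMap ⟨lowerStar ρ, continuous_lowerStar ρ⟩) (zetaIso A) prox_iff_zetaIso b
  exact h₁.trans ((reg_lowerStar_preimage_zeta ρ b).symm.trans h₂.symm)

end

/-! ### Representation of a de Vries extension by its compactification. -/

namespace DeVriesExtension

/-- An isomorphism of de Vries extensions, from isomorphisms of the two algebras that commute with the
extensions. -/
def isoMk {a a' : DeVriesExtension.{u}} (θ : a.A ≃o a'.A)
    (hθ : ∀ x y : a.A, a.A.prox x y ↔ a'.A.prox (θ x) (θ y)) (σ : a.B ≃o a'.B)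
    (h : ∀ x : a.A, σ (a.α x) = a'.α (θ x)) : a ≅ a' where
  hom :=
    { ρ := DeVriesHom.ofOrderIso θ hθ
      σ := CompleteLatticeHom.OrderIso.toCompleteLatticeHom σ
      comm := fun x => (h x).trans (star_ofOrderIso_apply a'.α θ hθ x).symm }
  inv :=
    { ρ := DeVriesHom.ofOrderIso θ.symm (prox_symm_iff hθ)
      σ := CompleteLatticeHom.OrderIso.toCompleteLatticeHom σ.symm
      comm := fun x => by
        rw [star_ofOrderIso_apply]
        refine σ.symm_apply_eq.2 ?_
        rw [h, θ.apply_symm_apply] }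
  hom_inv_id := Hom.ext
    (DeVriesHom.ext (funext fun x => (star_ofOrderIso_apply _ θ hθ x).trans (θ.symm_apply_apply x)))
    (DFunLike.ext _ _ fun x => σ.symm_apply_apply x)
  inv_hom_id := Hom.ext
    (DeVriesHom.ext (funext fun x =>
      (star_ofOrderIso_apply _ θ.symm (prox_symm_iff hθ) x).trans (θ.apply_symm_apply x)))
    (DFunLike.ext _ _ fun x => σ.apply_symm_apply x)

/-- The isomorphism from `B` onto the powerset of its set of atoms. -/
noncomputable def atomsIso (a : DeVriesExtension.{u}) : a.B ≃o Set a.AtomSpace where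
  toFun := fun b => {x | x.1 ≤ b}
  invFun := fun s => sSup (Subtype.val '' s)
  left_inv := fun b => by
    refine le_antisymm (sSup_le ?_) (BooleanAlgebra.le_iff_atom_le_imp.2 fun c hc hcb => ?_)
    · rintro _ ⟨x, hx, rfl⟩
      exact hx
    · exact le_sSup ⟨⟨c, hc⟩, hcb, rfl⟩
  right_inv := fun s => by
    refine Subset.antisymm (fun x hx => ?_) fun x hx => le_sSup (mem_image_of_mem _ hx)
    by_contra hxs
    have hle : sSup (Subtype.val '' s) ≤ x.1ᶜ := by
      refine sSup_le ?_
      rintro _ ⟨y, hy, rfl⟩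
      -- An atom below the atom `x` equals `x`; since `x` is not in `s`, every atom of `s` lies
      -- below the complement of `x`.
      refine (atom_le_or_le_compl y.2 x.1).resolve_left fun hyx => hxs ?_
      rwa [← show y = x from Subtype.ext ((x.2.le_iff.1 hyx).resolve_left y.2.1)]
    have h1 : x.1 ≤ x.1ᶜ := le_trans hx hle
    rw [le_compl_iff_disjoint_right, disjoint_self] at h1
    exact x.2.1 h1
  map_rel_iff' := fun {b c} =>
    ⟨fun h => BooleanAlgebra.le_iff_atom_le_imp.2 fun x hx hxb => h (a := ⟨x, hx⟩) hxb,
      fun h _ hx => le_trans hx h⟩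

/-- A de Vries extension is isomorphic to the one of the compactification of its atoms by its ends. -/
noncomputable def isoEC (a : DeVriesExtension.{u}) : a ≅ EObj (CObj a) :=
  isoMk (a' := EObj (CObj a)) (zetaIso a.A) prox_iff_zetaIso a.atomsIso
    fun b => Set.ext fun x => (a.mem_atomMap x b).symm

/-- The first component is naturality of `ζ`. The second is the adjunction `σ_+ x ≤ b ↔ x ≤ σ b`,
read on sets of atoms. -/
theorem isoEC_naturality {a a' : DeVriesExtension.{u}} (φ : a ⟶ a') :
    φ ≫ (isoEC a').hom = (isoEC a).hom ≫ EMap (CMap φ) :=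
  Hom.ext (zetaHom_naturality φ.ρ) (DFunLike.ext _ _ fun b =>
    Set.ext fun x => (sInf_le_iff_le_map φ.σ x.1 b).symm)

end DeVriesExtension

end DeVries

namespace DeVries

/-! ### Isomorphisms of compactifications. -/

namespace Compactification

/-- A morphism `(f, g)` of compactifications with `f` and `g` bijective is an isomorphism. -/
theorem isIso_of_bijective {e e' : Compactification.{u}} (φ : e ⟶ e')
    (hf : Function.Bijective φ.f) (hg : Function.Bijective φ.g) : IsIso φ := by
  let f := Equiv.ofBijective φ.f hf
  let g := Equiv.ofBijective φ.g hg
  have hgc : Continuous g.symm := Continuous.continuous_symm_of_equiv_compact_to_t2 φ.g.continuous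
  have hcomm : ∀ x, g.symm (e'.e x) = e.e (f.symm x) := fun x => by
    rw [Equiv.symm_apply_eq]
    change _ = φ.g _
    rw [φ.comm]
    exact congrArg e'.e (f.apply_symm_apply x).symm
  let ψ : Hom e' e :=
    -- Compactness is available only for `Y`; continuity of `f⁻¹` is inherited from `g⁻¹` through
    -- the embedding `e`, as `e ∘ f⁻¹ = g⁻¹ ∘ e'`.
    { f := ⟨f.symm, e.isEmbedding.continuous_iff.2
        ((hgc.comp e'.isEmbedding.continuous).congr hcomm)⟩
      g := ⟨g.symm, hgc⟩
      comm := hcomm }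
  exact ⟨ψ,
    Hom.ext (ContinuousMap.ext f.symm_apply_apply) (ContinuousMap.ext g.symm_apply_apply),
    Hom.ext (ContinuousMap.ext f.apply_symm_apply) (ContinuousMap.ext g.apply_symm_apply)⟩

end Compactification

/-! ### The points of a compact Hausdorff space as ends of its regular open algebra. -/

section

variable {Y Y' : Type u} [TopologicalSpace Y] [CompactSpace Y] [T2Space Y]
  [TopologicalSpace Y'] [CompactSpace Y'] [T2Space Y']

/-- The end of the regular open neighbourhoods of a point. -/
def nhdsEnd (y : Y) : Ends (upperStar Y) := ⟨{U : RO Y | y ∈ U.carrier}, by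
  refine isEnd_of_prime
    { top_mem := mem_univ y
      inf_mem := fun ha hb => ⟨ha, hb⟩
      mem_of_le := fun ha hab => hab ha
      bot_notMem := fun h => h
      round := ?_ } ?_
  · apply Subset.antisymm
    · rintro (U : RO Y) ⟨V, hV, hVU⟩
      exact hVU (subset_closure hV)
    · exact fun U hU => RO.exists_mem_closure_subset U.isOpen hU
  · intro (U : RO Y) (V : RO Y) (h : closure U.carrier ⊆ V.carrier)
    by_cases hy : y ∈ closure U.carrier
    · exact Or.inr (h hy)
    · left
      change y ∈ interior U.carrierᶜ
      rwa [interior_compl]⟩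

theorem continuous_nhdsEnd : Continuous (nhdsEnd : Y → Ends (upperStar Y)) := by
  refine continuous_generateFrom_iff.2 ?_
  rintro _ ⟨U, rfl⟩
  exact RO.isOpen U

theorem nhdsEnd_injective : Function.Injective (nhdsEnd : Y → Ends (upperStar Y)) := by
  intro y z h
  by_contra hne
  obtain ⟨U, hyU, hU⟩ := RO.exists_mem_closure_subset isClosed_singleton.isOpen_compl
    (show y ∈ ({z} : Set Y)ᶜ from hne)
  have hz : U ∈ (nhdsEnd z).1 := h ▸ (show U ∈ (nhdsEnd y).1 from hyU)
  exact hU (subset_closure hz) rfl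

/-- A nonempty `ζ(U)` forces `U` to be nonempty, since no end contains `⊥`; any point of `U` then
gives an end in `ζ(U)`. -/
theorem denseRange_nhdsEnd : DenseRange (nhdsEnd : Y → Ends (upperStar Y)) := by
  refine (DeVriesExtension.isTopologicalBasis_zeta (upperStar Y)).dense_iff.2 ?_
  rintro _ ⟨U, rfl⟩ ⟨z, hz⟩
  obtain ⟨y, hy⟩ : (RO.carrier U).Nonempty := by
    rw [nonempty_iff_ne_empty]
    intro h
    rw [show U = ⊥ from RO.ext h] at hz
    exact z.2.1.bot_notMem hz
  exact ⟨nhdsEnd y, hy, y, rfl⟩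

/-- The image is compact, hence closed in the Hausdorff space of ends, and it is dense. -/
theorem nhdsEnd_bijective : Function.Bijective (nhdsEnd : Y → Ends (upperStar Y)) := by
  refine ⟨nhdsEnd_injective, range_eq_univ.1 ?_⟩
  rw [← denseRange_nhdsEnd.closure_range,
    (isCompact_range continuous_nhdsEnd).isClosed.closure_eq]

/-- Ends are maximal, so one inclusion suffices: if `cl V ⊆ U`, then `int (cl (g⁻¹ V)) ⊆ g⁻¹ U`. -/
theorem lowerStar_upperStarMap_nhdsEnd (g : C(Y, Y')) (y : Y) :
    lowerStar (upperStarMap g) (nhdsEnd y) = nhdsEnd (g y) := by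
  refine Ends.eq_of_subset ?_
  rintro (U : RO Y') ⟨V, hV, hVU⟩
  exact reg_preimage_subset g hVU hV

end

/-! ### A compactification is naturally isomorphic to its double dual. -/

namespace Compactification

/-- The canonical morphism from a compactification `e : X → Y` to `C (E e)`, sending points of `X` to
singletons and points of `Y` to their regular open neighbourhoods. -/
def toCE (e : Compactification.{u}) : e ⟶ CObj (EObj e) :=
  have hcomm : ∀ x : e.X, nhdsEnd (e.e x) =
      (EObj e).atomMap ⟨({x} : Set e.X), Set.isAtom_singleton x⟩ := fun x => by
    refine Subtype.ext (Set.ext fun U => Iff.trans ?_ ((EObj e).mem_atomMap _ U).symm)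
    exact (singleton_subset_iff (s := e.e ⁻¹' RO.carrier U)).symm
  { f := ⟨fun x => ⟨({x} : Set e.X), Set.isAtom_singleton x⟩, continuous_induced_rng.2
      ((continuous_nhdsEnd.comp e.isEmbedding.continuous).congr hcomm)⟩
    g := ⟨nhdsEnd, continuous_nhdsEnd⟩
    comm := hcomm }

instance (e : Compactification.{u}) : IsIso e.toCE := by
  refine isIso_of_bijective _ ⟨fun x y h => ?_, ?_⟩ nhdsEnd_bijective
  · exact singleton_injective (congrArg Subtype.val h)
  · rintro ⟨s, hs⟩
    obtain ⟨x, rfl⟩ := Set.isAtom_iff.1 hs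
    exact ⟨x, rfl⟩

theorem toCE_naturality {e e' : Compactification.{u}} (φ : e ⟶ e') :
    φ ≫ e'.toCE = e.toCE ≫ CMap (EMap φ) := by
  refine Hom.ext (ContinuousMap.ext fun x => Subtype.ext ?_) (ContinuousMap.ext fun y => ?_)
  -- The least set whose preimage under `f` contains `x` is `{f x}`.
  · change ({φ.f x} : Set e'.X) = sInf {s | {x} ⊆ φ.f ⁻¹' s}
    refine Subset.antisymm (subset_sInter fun s hs => ?_) (sInter_subset_of_mem ?_)
    · exact singleton_subset_iff.2 (hs rfl)
    · exact singleton_subset_iff.2 rfl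
  · exact (lowerStar_upperStarMap_nhdsEnd φ.g y).symm

end Compactification

/-- The natural isomorphism from the identity of compactifications to `C ∘ E`. -/
noncomputable def unitIso : 𝟭 Compactification.{u}ᵒᵖ ≅ E ⋙ C.rightOp :=
  -- In the opposite category `toCE` points from the double dual back to `e`, so the isomorphism is
  -- built in that direction and then inverted.
  (NatIso.ofComponents (F := E ⋙ C.rightOp) (G := 𝟭 _)
    (fun e => (asIso e.unop.toCE).op)
    fun φ => congrArg Quiver.Hom.op (Compactification.toCE_naturality φ.unop).symm).symm

/-- The natural isomorphism from `E ∘ C` to the identity of de Vries extensions. -/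
noncomputable def counitIso : C.rightOp ⋙ E ≅ 𝟭 DeVriesExtension.{u} :=
  (NatIso.ofComponents (F := 𝟭 _) (G := C.rightOp ⋙ E)
    DeVriesExtension.isoEC
    fun φ => DeVriesExtension.isoEC_naturality φ).symm

end DeVries

theorem theorem5p5 :
    ∃ F : DeVries.Compactification.{u}ᵒᵖ ≌ DeVries.DeVriesExtension.{u},
      F.functor = DeVries.E ∧ F.inverse = DeVries.C.rightOp :=
  -- `Equivalence.mk` adjusts the unit so that the triangle identity holds and leaves both functors
  -- unchanged; two natural isomorphisms are all it needs.
  ⟨CategoryTheory.Equivalence.mk DeVries.E DeVries.C.rightOp DeVries.unitIso DeVries.counitIso,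
    rfl, rfl⟩
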